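/- Conventions. All matroids have a finite ground set. For a matroid $M$ on $E$, $P(M)\subset\mathbb R^E$ is the convex hull of the incidence vectors of the bases of $M$, and $M|_A$ is the restriction of $M$ to $A$. A *hyperplane split* of $P(M)$ is an equality $P(M)=P(M_1)\cup P(M_2)$ with matroids $M_1,M_2$ on $E$ such that $P(M_1)\cap P(M_2)$ is a face of both $P(M_1)$ and $P(M_2)$ and $P(M_1)\ne P(M)\ne P(M_2)$. A *sequence of $s$ successive hyperplane splits of $P(M)$ with pieces* $P(N_1),\dots,P(N_{s+1})$ consists of matroids $M=R_1,R_2,\dots,R_{s+1}=N_{s+1}$ and $N_1,\dots,N_s$ such that $P(R_j)=P(N_j)\cup P(R_{j+1})$ is a hyperplane split for every $1\le j\le s$, such that $P(M)=\bigcup_{j=1}^{s+1}P(N_j)$, and such that for all $j\ne k$ the intersection $P(N_j)\cap P(N_k)$ is either empty or the base polytope of a matroid on $E$ whose bases are the common bases of $N_j$ and $N_k$. Let $t\ge 2$ and let $M$ be a matroid of rank $r$ on $E$. A partition $E=E_1\cup\dots\cup E_t$ is a *good $t$-partition* of $M$ with integers $a_1,\dots,a_t$ if $0<a_i<r(M|_{E_i})$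 for all $i$, $r=\sum_{i=1}^t a_i$, and (a) for all $1\le j\le t-1$: if $X$ is independent in $M|_{E_1\cup\dots\cup E_j}$ with $|X|\le\sum_{i=1}^{j}a_i$ and $Y$ is independent in $M|_{E_{j+1}\cup\dots\cup E_t}$ with $|Y|\le\sum_{i=j+1}^{t}a_i$, then $X\cup Y$ is independent in $M$; (b) for all $1\le j<k\le t-1$: if $X$, $Y$, $Z$ are independent in the restrictions of $M$ to $E_1\cup\dots\cup E_j$, $E_{j+1}\cup\dots\cup E_k$, $E_{k+1}\cup\dots\cup E_t$ and have at most $\sum_{i=1}^{j}a_i$, $\sum_{i=j+1}^{k}a_i$, $\sum_{i=k+1}^{t}a_i$ elements respectively, then $X\cup Y\cup Z$ is independent in $M$. A *relaxation* of $M$ is a matroid $M'$ on $E$ whose bases are the bases of $M$ together with one set $X$ that is both a circuit and a hyperplane (a flat of rank $r-1$) of $M$. **Corollary.** Let $E=E_1\cup\dots\cup E_t$ be a good $t$-partition of a matroid $M$ with integers $a_1,\dots,a_t$, and let $M'$ be a relaxation of $M$. Then: 1. For $1\le j\le t$ the set $$\Big\{B\in\mathcal B(M') : \big|B\cap\textstyle\bigcup_{l=1}^{i}E_l\big|\ge\sum_{l=1}^{i}a_l\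 \text{ for all } 1\le i<j,\ \ \big|B\cap\textstyle\bigcup_{l=1}^{j}E_l\big|\le\sum_{l=1}^{j}a_l\Big\}$$ is the collection of bases of a matroid $M'_j$ on $E$. The polytopes $P(M'_1),\dots,P(M'_t)$ are, in this order, the $t$ pieces of a sequence of $t-1$ successive hyperplane splits of $P(M')$, and any two of the matroids $M'_j$ have a common base (so no two of the pieces are disjoint). 2. $P(M')$ also has a sequence of $t$ successive hyperplane splits (with $t+1$ pieces). -/

import Mathlib

open scoped Matroid

/-- The incidence vector of a set `B`: the sum of the standard basis vectors `e_i`, `i ∈ B`. -/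
noncomputable def incidenceVector {α : Type*} (B : Set α) : α → ℝ :=
  B.indicator fun _ => 1

/-- The base polytope `P(M)`: the convex hull of the incidence vectors of the bases of `M`. -/
def basePolytope {α : Type*} (M : Matroid α) : Set (α → ℝ) :=
  convexHull ℝ {x | ∃ B, M.IsBase B ∧ x = incidenceVector B}

/-- `P(M) = P(M₁) ∪ P(M₂)` is a hyperplane split: `M₁` and `M₂` are matroids on the ground set
of `M`, the intersection of the two pieces is a face of both, and both pieces are proper.
(For a polytope, the faces are exactly the exposed subsets.) -/
structure IsHyperplaneSplit {α : Type*} (M M₁ M₂ : Matroid α) : Prop where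
  ground_left : M₁.E = M.E
  ground_right : M₂.E = M.E
  union : basePolytope M = basePolytope M₁ ∪ basePolytope M₂
  face_left : IsExposed ℝ (basePolytope M₁) (basePolytope M₁ ∩ basePolytope M₂)
  face_right : IsExposed ℝ (basePolytope M₂) (basePolytope M₁ ∩ basePolytope M₂)
  proper_left : basePolytope M₁ ≠ basePolytope M
  proper_right : basePolytope M₂ ≠ basePolytope M

/-- `N 0, …, N (m - 1)` are the `m` pieces obtained from `M` by a sequence of `m - 1` successive
hyperplane splits: `R 0 = M`, each remainder `R j` is split into the piece `N j` and the next
remainder `R (j + 1)`, and the last remainder is the last piece.  The base polytopes of the pieces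
cover that of `M`, and any two of them are disjoint or meet in the base polytope of a matroid,
whose bases are the common bases of the two pieces. -/
structure IsHyperplaneSplitSequence {α : Type*} {m : ℕ} (M : Matroid α)
    (N : Fin m → Matroid α) : Prop where
  splits : ∃ R : Fin m → Matroid α,
    (∀ j : Fin m, (j : ℕ) = 0 → R j = M) ∧
    (∀ (j : Fin m) (h : (j : ℕ) + 1 < m), IsHyperplaneSplit (R j) (N j) (R ⟨j + 1, h⟩)) ∧
    (∀ j : Fin m, (j : ℕ) + 1 = m → R j = N j)
  union : basePolytope M = ⋃ j, basePolytope (N j)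
  inter : ∀ j k : Fin m, j ≠ k → (basePolytope (N j) ∩ basePolytope (N k)).Nonempty →
    ∃ L : Matroid α, L.E = M.E ∧
      (∀ B, L.IsBase B ↔ (N j).IsBase B ∧ (N k).IsBase B) ∧
      basePolytope (N j) ∩ basePolytope (N k) = basePolytope L

/-- The union of the parts `E i` with `i ∈ s`. -/
def partUnion {α : Type*} {t : ℕ} (E : Fin t → Set α) (s : Finset (Fin t)) : Set α :=
  ⋃ i ∈ s, E i

/-- `E 0, …, E (t - 1)` is a good `t`-partition of the ground set of `M`, with the integers
`a 0, …, a (t - 1)`. -/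
structure IsGoodPartition {α : Type*} {t : ℕ} (M : Matroid α) (E : Fin t → Set α)
    (a : Fin t → ℕ) : Prop where
  two_le : 2 ≤ t
  disjoint : ∀ i j, i ≠ j → Disjoint (E i) (E j)
  union : ⋃ i, E i = M.E
  pos : ∀ i, 0 < a i
  lt_rank : ∀ i, (a i : ℕ∞) < (M ↾ E i).eRank
  sum_eq : M.eRank = ((∑ i, a i : ℕ) : ℕ∞)
  indep_two : ∀ j : Fin t, (j : ℕ) + 1 < t → ∀ X Y : Set α,
    (M ↾ partUnion E (Finset.Iic j)).Indep X →
    X.encard ≤ ((∑ i ∈ Finset.Iic j, a i : ℕ) : ℕ∞) →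
    (M ↾ partUnion E (Finset.Ioi j)).Indep Y →
    Y.encard ≤ ((∑ i ∈ Finset.Ioi j, a i : ℕ) : ℕ∞) →
    M.Indep (X ∪ Y)
  indep_three : ∀ j k : Fin t, j < k → (k : ℕ) + 1 < t → ∀ X Y Z : Set α,
    (M ↾ partUnion E (Finset.Iic j)).Indep X →
    X.encard ≤ ((∑ i ∈ Finset.Iic j, a i : ℕ) : ℕ∞) →
    (M ↾ partUnion E (Finset.Ioc j k)).Indep Y →
    Y.encard ≤ ((∑ i ∈ Finset.Ioc j k, a i : ℕ) : ℕ∞) →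
    (M ↾ partUnion E (Finset.Ioi k)).Indep Z →
    Z.encard ≤ ((∑ i ∈ Finset.Ioi k, a i : ℕ) : ℕ∞) →
    M.Indep (X ∪ Y ∪ Z)

/-- `X` is both a circuit and a hyperplane (a flat of rank `r(M) - 1`) of `M`. -/
structure IsCircuitHyperplane {α : Type*} (M : Matroid α) (X : Set α) : Prop where
  isCircuit : M.IsCircuit X
  isFlat : M.IsFlat X
  rank_add_one : M.eRk X + 1 = M.eRank

/-- `M'` is a relaxation of `M`: it is the matroid on the ground set of `M` whose bases are the
bases of `M` and one circuit-hyperplane of `M`. -/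
def IsRelaxation {α : Type*} (M M' : Matroid α) : Prop :=
  ∃ X, IsCircuitHyperplane M X ∧ M'.E = M.E ∧ ∀ B, M'.IsBase B ↔ M.IsBase B ∨ B = X

/-! Let `A n` be the union of the first n parts and `s n` the sum of the first n integers. Condition
(a) says that independent sets inside and outside `A n`, of sizes at most `s n` and `r - s n`, have
independent union; `IsCutChain` abstracts this. Two facts carry the proof. Combinatorial
(`IsCutChain.exchange`): for such a chain, the bases obeying any selection of the constraints |B ∩ A
n| ≥ s n and |B ∩ A n| ≤ s n satisfy basis exchange. Polyhedral (`mem_convexHull_of_le`): a single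
exchange changes |B ∩ A| by at most one, so an integral hyperplane x(A) = s cuts a base polytope
without creating new vertices. Cutting along the members of the chain therefore leaves base
polytopes on both sides.

A chain of M is also one of M': the relaxed set X has r elements, too many to be one of two nonempty
sets that are glued. This gives the t pieces. For one more piece, note that the bases of M are the
bases of M' with at least one element outside X. The cut x(E \ X) = 1 thus splits P(M') into a piece
around X and P(M), which the chain cuts further; the cut is proper by
`IsCutChain.exists_base_one_lt`. -/

open Set

/-! ### Cutting base polytopes by half-spaces -/

section Polytope

variable {α : Type*}

/-- The symmetric exchange property of the bases of a matroid. -/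
theorem Matroid.IsBase.symmetric_exchange {M : Matroid α} {B B' : Set α} (hB : M.IsBase B)
    (hB' : M.IsBase B') {x : α} (hx : x ∈ B \ B') :
    ∃ y ∈ B' \ B, M.IsBase (insert y (B \ {x})) ∧ M.IsBase (insert x (B' \ {y})) := by
  have hxE : x ∈ M.E := hB.subset_ground hx.1
  have hC := hB'.fundCircuit_isCircuit hxE hx.2
  have hK := Matroid.fundCocircuit_isCocircuit hx.1 hB
  -- A circuit and a cocircuit never meet in a single element; these two share `x`, hence also some
  -- `y ≠ x`.
  obtain ⟨y, ⟨hyC, hyK⟩, hyx⟩ := (hC.isCocircuit_inter_nontrivial hK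
    ⟨x, M.mem_fundCircuit x B', M.mem_fundCocircuit x B⟩).exists_ne x
  have hyB' : y ∈ B' := by
    simpa [hyx] using M.fundCircuit_subset_insert x B' hyC
  have hyB : y ∈ M.E \ B := by
    simpa [hyx] using M.fundCocircuit_subset_insert_compl x B hyK
  rw [hB.mem_fundCocircuit_iff_mem_fundCircuit,
    hB.indep.mem_fundCircuit_iff (by rw [hB.closure_eq]; exact hyB.1) hyB.2] at hyK
  rw [hB'.indep.mem_fundCircuit_iff (by rwa [hB'.closure_eq]) hx.2] at hyC
  refine ⟨y, ⟨hyB', hyB.2⟩, hB.exchange_isBase_of_indep' hx.1 hyB.2 hyK |> fun h ↦ ?_,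
    hB'.exchange_isBase_of_indep' hyB' hx.2 hyC |> fun h ↦ ?_⟩
  · rwa [insert_sdiff_singleton_comm hyx]
  · rwa [insert_sdiff_singleton_comm hyx.symm]

/-- Symmetric exchange preserves the sum of the two vectors, so what one base gains under a linear
functional the other loses. -/
theorem incidenceVector_exchange_add (B B' : Set α) {x y : α} (hx : x ∈ B \ B')
    (hy : y ∈ B' \ B) :
    incidenceVector (insert y (B \ {x})) + incidenceVector (insert x (B' \ {y})) =
      incidenceVector B + incidenceVector B' := by
  classical
  obtain ⟨hx, hx'⟩ := hx
  obtain ⟨hy, hy'⟩ := hy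
  ext z
  simp only [incidenceVector, Pi.add_apply, indicator_apply, mem_insert_iff, mem_sdiff,
    mem_singleton_iff]
  by_cases hzx : z = x
  · subst hzx
    have : z ≠ y := by rintro rfl; contradiction
    simp [*]
  · by_cases hzy : z = y
    · subst hzy
      simp [*]
    · simp [*]

theorem incidenceVector_mem_basePolytope {M : Matroid α} {B : Set α} (hB : M.IsBase B) :
    incidenceVector B ∈ basePolytope M :=
  subset_convexHull ℝ _ ⟨B, hB, rfl⟩

theorem basePolytope_mono {M N : Matroid α} (h : ∀ B, M.IsBase B → N.IsBase B) :
    basePolytope M ⊆ basePolytope N :=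
  convexHull_mono (by rintro _ ⟨B, hB, rfl⟩; exact ⟨B, h B hB, rfl⟩)

theorem le_of_mem_basePolytope {M : Matroid α} (f : StrongDual ℝ (α → ℝ)) (s : ℝ)
    (h : ∀ B, M.IsBase B → f (incidenceVector B) ≤ s) {p : α → ℝ} (hp : p ∈ basePolytope M) :
    f p ≤ s := by
  have : basePolytope M ⊆ {p | f p ≤ s} :=
    convexHull_min (by rintro _ ⟨B, hB, rfl⟩; exact h B hB)
      (convex_halfSpace_le f.toLinearMap.isLinear s)
  exact this hp

/-- Among the bases that maximize a linear functional `g`, the values of a functional `f` that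
cannot jump over `s` in an exchange do not jump over `s`. -/
theorem exists_optimal_base_eq [Finite α] {M : Matroid α} (f g : StrongDual ℝ (α → ℝ)) (s c : ℝ)
    (hstep : ∀ B x y, M.IsBase B → x ∈ B → y ∉ B → M.IsBase (insert y (B \ {x})) →
      s < f (incidenceVector B) → s ≤ f (incidenceVector (insert y (B \ {x}))))
    (hmax : ∀ B, M.IsBase B → g (incidenceVector B) ≤ c)
    (n : ℕ) : ∀ B₁ B₂ : Set α, (B₁ \ B₂).ncard ≤ n → M.IsBase B₁ → M.IsBase B₂ →
      g (incidenceVector B₁) = c → g (incidenceVector B₂) = c →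
      s ≤ f (incidenceVector B₁) → f (incidenceVector B₂) ≤ s →
      ∃ B, M.IsBase B ∧ g (incidenceVector B) = c ∧ f (incidenceVector B) = s := by
  induction n with
  | zero =>
    intro B₁ B₂ hn h₁ h₂ hg₁ _ hf₁ hf₂
    have hsub : B₁ ⊆ B₂ := by
      rw [← sdiff_eq_empty, ← ncard_eq_zero (toFinite _)]
      omega
    obtain rfl := h₁.eq_of_subset_isBase h₂ hsub
    exact ⟨B₁, h₁, hg₁, le_antisymm hf₂ hf₁⟩
  | succ n ih =>
    intro B₁ B₂ hn h₁ h₂ hg₁ hg₂ hf₁ hf₂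
    rcases hf₁.eq_or_lt with hf | hf
    · exact ⟨B₁, h₁, hg₁, hf.symm⟩
    rcases (B₁ \ B₂).eq_empty_or_nonempty with he | ⟨x, hx⟩
    · obtain rfl := h₁.eq_of_subset_isBase h₂ (sdiff_eq_empty.1 he)
      exact ⟨B₁, h₁, hg₁, le_antisymm hf₂ hf₁⟩
    obtain ⟨y, hy, hb₁, hb₂⟩ := h₁.symmetric_exchange h₂ hx
    -- The exchanged bases have total `g`-value 2c and neither exceeds c, so both remain optimal.
    have hsum := congrArg g (incidenceVector_exchange_add B₁ B₂ hx hy)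
    rw [map_add, map_add, hg₁, hg₂] at hsum
    have hle₁ := hmax _ hb₁
    have hle₂ := hmax _ hb₂
    refine ih (insert y (B₁ \ {x})) B₂ ?_ hb₁ h₂ (by linarith) hg₂
      (hstep B₁ x y h₁ hx.1 hy.2 hb₁ hf) hf₂
    have hlt : (insert y (B₁ \ {x}) \ B₂) ⊂ B₁ \ B₂ := by
      refine ⟨?_, fun h ↦ ?_⟩
      · rintro z ⟨rfl | hz, hz'⟩
        · exact absurd hy.1 hz'
        · exact ⟨hz.1, hz'⟩
      · rcases (h hx).1 with rfl | h'
        · exact hy.2 hx.1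
        · exact h'.2 rfl
    have := ncard_lt_ncard hlt (toFinite _)
    omega

/-- If a functional `f` cannot jump over `s` from above in an exchange of bases, then the
half-space `f ≤ s` cuts out of the base polytope the convex hull of the bases it contains. -/
theorem mem_convexHull_of_le [Finite α] {M : Matroid α} (f : StrongDual ℝ (α → ℝ)) (s : ℝ)
    (hstep : ∀ B x y, M.IsBase B → x ∈ B → y ∉ B → M.IsBase (insert y (B \ {x})) →
      s < f (incidenceVector B) → s ≤ f (incidenceVector (insert y (B \ {x}))))
    {p : α → ℝ} (hp : p ∈ basePolytope M) (hfp : f p ≤ s) :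
    p ∈ convexHull ℝ {x | ∃ B, (M.IsBase B ∧ f (incidenceVector B) ≤ s) ∧
      x = incidenceVector B} := by
  by_contra hcon
  have hfin : {x : α → ℝ | ∃ B, (M.IsBase B ∧ f (incidenceVector B) ≤ s) ∧
      x = incidenceVector B}.Finite :=
    (toFinite (range (incidenceVector : Set α → α → ℝ))).subset
      (by rintro _ ⟨B, -, rfl⟩; exact ⟨B, rfl⟩)
  obtain ⟨w, u, hw, hu⟩ := geometric_hahn_banach_closed_point (convex_convexHull ℝ _)
    (hfin.isClosed_convexHull ℝ) hcon
  have hwV : ∀ B, M.IsBase B → f (incidenceVector B) ≤ s → w (incidenceVector B) < u :=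
    fun B h h' ↦ hw _ (subset_convexHull ℝ _ ⟨B, ⟨h, h'⟩, rfl⟩)
  -- `l` is a Lagrange multiplier for `f ≤ s`, and `l = 0 ∨ f = s` is complementary slackness: it
  -- turns maximality of `B` into w p ≤ w B < u, against the separation.
  suffices h : ∃ l : ℝ, 0 ≤ l ∧ ∃ B, M.IsBase B ∧ f (incidenceVector B) ≤ s ∧
      (l = 0 ∨ f (incidenceVector B) = s) ∧
      ∀ B', M.IsBase B' → (w - l • f) (incidenceVector B') ≤ (w - l • f) (incidenceVector B) by
    obtain ⟨l, hl, B, hB, hfB, hlB, hmax⟩ := h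
    have h1 := le_of_mem_basePolytope (w - l • f) _ hmax hp
    have h2 := hwV B hB hfB
    simp only [sub_apply, smul_apply, smul_eq_mul] at h1
    rcases hlB with rfl | h
    · linarith
    · rw [h] at h1
      nlinarith
  let V : Set (Set α) := {B | M.IsBase B ∧ f (incidenceVector B) ≤ s}
  let U : Set (Set α) := {B | M.IsBase B ∧ s < f (incidenceVector B)}
  have hV : V.Nonempty := by
    by_contra hne
    rw [not_nonempty_iff_eq_empty] at hne
    have hgt : ∀ B, M.IsBase B → s < f (incidenceVector B) := fun B hB ↦ by
      by_contra h
      exact (hne ▸ (⟨hB, not_lt.1 h⟩ : B ∈ V) : B ∈ (∅ : Set (Set α)))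
    have : basePolytope M ⊆ {p | s < f p} :=
      convexHull_min (by rintro _ ⟨B, hB, rfl⟩; exact hgt B hB)
        (convex_halfSpace_gt f.toLinearMap.isLinear s)
    exact absurd (this hp) (not_lt.2 hfp)
  obtain ⟨B₀, hB₀, hB₀max⟩ := exists_max_image V (fun B ↦ w (incidenceVector B)) (toFinite _) hV
  by_cases hzero : ∀ B ∈ U, w (incidenceVector B) ≤ w (incidenceVector B₀)
  · refine ⟨0, le_rfl, B₀, hB₀.1, hB₀.2, Or.inl rfl, fun B hB ↦ ?_⟩
    simp only [zero_smul, sub_zero]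
    rcases le_or_gt (f (incidenceVector B)) s with h | h
    · exact hB₀max B ⟨hB, h⟩
    · exact hzero B ⟨hB, h⟩
  push Not at hzero
  obtain ⟨B₃, hB₃, hlt₃⟩ := hzero
  -- Plot the bases as points (f, w). `σ` is the slope of a chord across the line f = s, and the
  -- min-max slope `l` is that of the upper hull edge crossing this line.
  let σ : Set α → Set α → ℝ := fun B B' ↦
    (w (incidenceVector B) - w (incidenceVector B')) /
      (f (incidenceVector B) - f (incidenceVector B'))
  have hU : ∀ B', ∃ B ∈ U, ∀ C ∈ U, σ C B' ≤ σ B B' := fun B' ↦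
    exists_max_image U (fun B ↦ σ B B') (toFinite _) ⟨B₃, hB₃⟩
  choose top htopU htop using hU
  obtain ⟨B₂, hB₂, hmin⟩ := exists_min_image V (fun B' ↦ σ (top B') B') (toFinite _) hV
  set l := σ (top B₂) B₂ with hl
  have hpos : ∀ B ∈ U, ∀ B' ∈ V, 0 < f (incidenceVector B) - f (incidenceVector B') :=
    fun B hB B' hB' ↦ by linarith [hB.2, hB'.2]
  have hl0 : 0 ≤ l := by
    refine le_trans ?_ (htop B₂ B₃ hB₃)
    exact div_nonneg (by linarith [hB₀max B₂ hB₂]) (hpos _ hB₃ _ hB₂).le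
  have hUle : ∀ B ∈ U, (w - l • f) (incidenceVector B) ≤ (w - l • f) (incidenceVector B₂) := by
    intro B hB
    have h := htop B₂ B hB
    rw [← hl, div_le_iff₀ (hpos _ hB _ hB₂)] at h
    simp only [sub_apply, smul_apply, smul_eq_mul]
    linarith
  have heq : (w - l • f) (incidenceVector (top B₂)) = (w - l • f) (incidenceVector B₂) := by
    have h := hl
    rw [eq_div_iff (hpos _ (htopU B₂) _ hB₂).ne'] at h
    simp only [sub_apply, smul_apply, smul_eq_mul]
    linarith
  have hmax : ∀ B, M.IsBase B →
      (w - l • f) (incidenceVector B) ≤ (w - l • f) (incidenceVector B₂) := by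
    intro B hB
    rcases le_or_gt (f (incidenceVector B)) s with h | h
    · refine le_trans ?_ (hUle _ (htopU B))
      have h' := hmin B ⟨hB, h⟩
      rw [le_div_iff₀ (hpos _ (htopU B) _ ⟨hB, h⟩)] at h'
      simp only [sub_apply, smul_apply, smul_eq_mul]
      linarith
    · exact hUle B ⟨hB, h⟩
  -- The edge has optimal bases on both sides of f = s; exchanges within the optimal face must hit
  -- the value s.
  obtain ⟨B, hB, hgB, hfB⟩ := exists_optimal_base_eq f (w - l • f) s _ hstep hmax _ (top B₂) B₂
    le_rfl (htopU B₂).1 hB₂.1 heq rfl (htopU B₂).2.le hB₂.2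
  exact ⟨l, hl0, B, hB, hfB.le, Or.inr hfB, fun B' hB' ↦ hgB ▸ hmax B' hB'⟩

/-- The sum of the coordinates in `A`. -/
noncomputable def coordSum [Finite α] (A : Set α) : StrongDual ℝ (α → ℝ) :=
  ∑ i ∈ A.toFinite.toFinset, ContinuousLinearMap.proj i

theorem coordSum_incidenceVector [Finite α] (A B : Set α) :
    coordSum A (incidenceVector B) = ((B ∩ A).ncard : ℝ) := by
  classical
  simp only [coordSum, sum_apply, ContinuousLinearMap.proj_apply,
    incidenceVector, indicator_apply]
  rw [Finset.sum_boole, ncard_eq_toFinset_card _ (toFinite _)]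
  congr 2
  ext i
  simp [and_comm]

theorem ncard_inter_le_exchange [Finite α] (A B : Set α) (x y : α) :
    (B ∩ A).ncard ≤ (insert y (B \ {x}) ∩ A).ncard + 1 := by
  have h : B ∩ A ⊆ insert x (insert y (B \ {x}) ∩ A) := fun z hz ↦ by
    by_cases hzx : z = x
    · exact Or.inl hzx
    · exact Or.inr ⟨Or.inr ⟨hz.1, hzx⟩, hz.2⟩
  exact (ncard_le_ncard h (toFinite _)).trans (ncard_insert_le _ _)

theorem ncard_exchange_inter_le [Finite α] (A B : Set α) (x y : α) :
    (insert y (B \ {x}) ∩ A).ncard ≤ (B ∩ A).ncard + 1 := by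
  have h : insert y (B \ {x}) ∩ A ⊆ insert y (B ∩ A) := by
    rintro z ⟨rfl | hz, hzA⟩
    · exact Or.inl rfl
    · exact Or.inr ⟨hz.1, hzA⟩
  exact (ncard_le_ncard h (toFinite _)).trans (ncard_insert_le _ _)

/-- Cutting a base polytope by `x(A) ≤ s`. -/
theorem basePolytope_inter_le [Finite α] {M N : Matroid α} {A : Set α} {s : ℕ}
    (h : ∀ B, N.IsBase B ↔ M.IsBase B ∧ (B ∩ A).ncard ≤ s) :
    basePolytope N = basePolytope M ∩ {p | coordSum A p ≤ s} := by
  refine Subset.antisymm (fun p hp ↦ ⟨basePolytope_mono (fun B hB ↦ ((h B).1 hB).1) hp,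
    le_of_mem_basePolytope _ _ (fun B hB ↦ ?_) hp⟩) ?_
  · rw [coordSum_incidenceVector]
    exact_mod_cast ((h B).1 hB).2
  · rintro p ⟨hp, hps⟩
    have := mem_convexHull_of_le (M := M) (coordSum A) s (fun B x y _ _ _ _ hlt ↦ ?_) hp hps
    · refine convexHull_mono ?_ this
      rintro _ ⟨B, ⟨hB, hBs⟩, rfl⟩
      rw [coordSum_incidenceVector] at hBs
      exact ⟨B, (h B).2 ⟨hB, by exact_mod_cast hBs⟩, rfl⟩
    · rw [coordSum_incidenceVector] at hlt ⊢
      have := ncard_inter_le_exchange A B x y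
      have hlt' : s < (B ∩ A).ncard := by exact_mod_cast hlt
      exact_mod_cast (by omega : s ≤ (insert y (B \ {x}) ∩ A).ncard)

/-- Cutting a base polytope by `x(A) ≥ s`. -/
theorem basePolytope_inter_ge [Finite α] {M N : Matroid α} {A : Set α} {s : ℕ}
    (h : ∀ B, N.IsBase B ↔ M.IsBase B ∧ s ≤ (B ∩ A).ncard) :
    basePolytope N = basePolytope M ∩ {p | (s : ℝ) ≤ coordSum A p} := by
  refine Subset.antisymm (fun p hp ↦ ⟨basePolytope_mono (fun B hB ↦ ((h B).1 hB).1) hp, ?_⟩) ?_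
  · have := le_of_mem_basePolytope (-coordSum A) (-s) (fun B hB ↦ ?_) hp
    · simpa using this
    · rw [neg_apply, coordSum_incidenceVector]
      exact neg_le_neg (by exact_mod_cast ((h B).1 hB).2)
  · rintro p ⟨hp, hps⟩
    have := mem_convexHull_of_le (M := M) (-coordSum A) (-s) (fun B x y _ _ _ _ hlt ↦ ?_) hp
      (by simpa using hps)
    · refine convexHull_mono ?_ this
      rintro _ ⟨B, ⟨hB, hBs⟩, rfl⟩
      rw [neg_apply, coordSum_incidenceVector, neg_le_neg_iff] at hBs
      exact ⟨B, (h B).2 ⟨hB, by exact_mod_cast hBs⟩, rfl⟩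
    · rw [neg_apply, coordSum_incidenceVector] at hlt ⊢
      have := ncard_exchange_inter_le A B x y
      have hlt' : (B ∩ A).ncard < s := by exact_mod_cast neg_lt_neg_iff.1 hlt
      exact neg_le_neg (by exact_mod_cast (by omega : (insert y (B \ {x}) ∩ A).ncard ≤ s))

/-- If all bases of `M` meet `A` in at least `s` elements and one of them in exactly `s`, the bases
that meet `A` in exactly `s` elements are the bases of a matroid. -/
theorem exists_matroid_isBase_iff_ncard_inter_le [Finite α] {M : Matroid α} {A : Set α} {s : ℕ}
    (hge : ∀ B, M.IsBase B → s ≤ (B ∩ A).ncard) (hex : ∃ B, M.IsBase B ∧ (B ∩ A).ncard ≤ s) :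
    ∃ L : Matroid α, L.E = M.E ∧ ∀ B, L.IsBase B ↔ M.IsBase B ∧ (B ∩ A).ncard ≤ s := by
  refine ⟨Matroid.ofIsBaseOfFinite (E := M.E) (toFinite _)
    (fun B ↦ M.IsBase B ∧ (B ∩ A).ncard ≤ s) hex ?_ (fun B hB ↦ hB.1.subset_ground), rfl,
    fun B ↦ Iff.rfl⟩
  rintro B B' ⟨hB, hBs⟩ ⟨hB', hBs'⟩ x hx
  obtain ⟨y, hy, hb, hb'⟩ := hB.symmetric_exchange hB' hx
  refine ⟨y, hy, hb, ?_⟩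
  -- The two exchanged bases together have at most 2s elements in `A`, and the other one has at
  -- least s.
  have hsum := congrArg (coordSum A) (incidenceVector_exchange_add B B' hx hy)
  simp only [map_add, coordSum_incidenceVector] at hsum
  have h' := hge _ hb'
  norm_cast at hsum
  omega

end Polytope

/-! ### Hyperplane splits from successive cuts -/

section Splits

variable {α : Type*} [Finite α]

/-- Cutting a base polytope along `x(A) = s` is a hyperplane split if the bases on both sides of
the cut are those of matroids and there are bases strictly on both sides. -/
theorem isHyperplaneSplit_of_cut {M M₁ M₂ : Matroid α} {A : Set α} {s : ℕ}
    (hE₁ : M₁.E = M.E) (hE₂ : M₂.E = M.E)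
    (h₁ : ∀ B, M₁.IsBase B ↔ M.IsBase B ∧ (B ∩ A).ncard ≤ s)
    (h₂ : ∀ B, M₂.IsBase B ↔ M.IsBase B ∧ s ≤ (B ∩ A).ncard)
    (hlt : ∃ B, M.IsBase B ∧ (B ∩ A).ncard < s) (hgt : ∃ B, M.IsBase B ∧ s < (B ∩ A).ncard) :
    IsHyperplaneSplit M M₁ M₂ := by
  have hP₁ := basePolytope_inter_le h₁
  have hP₂ := basePolytope_inter_ge h₂
  refine ⟨hE₁, hE₂, ?_, fun _ ↦ ⟨coordSum A, ?_⟩, fun _ ↦ ⟨-coordSum A, ?_⟩, ?_, ?_⟩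
  · rw [hP₁, hP₂, ← inter_union_distrib_left, eq_comm, inter_eq_left]
    exact fun p _ ↦ le_total (coordSum A p) s
  -- Any common point `q` attains the value s, which is the maximum of x(A) on the left piece; so
  -- the intersection is the face where x(A) is maximal.
  · obtain ⟨q, hq⟩ := ‹(basePolytope M₁ ∩ basePolytope M₂).Nonempty›
    rw [hP₁, hP₂] at hq ⊢
    ext p
    constructor
    · rintro ⟨hp, -, hp'⟩
      exact ⟨hp, fun y hy ↦ hy.2.trans hp'⟩
    · rintro ⟨hp, hmax⟩
      exact ⟨hp, hp.1, hq.2.2.trans (hmax q hq.1)⟩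
  · obtain ⟨q, hq⟩ := ‹(basePolytope M₁ ∩ basePolytope M₂).Nonempty›
    rw [hP₁, hP₂] at hq ⊢
    ext p
    simp only [neg_apply, neg_le_neg_iff]
    constructor
    · rintro ⟨⟨-, hp'⟩, hp⟩
      exact ⟨hp, fun y hy ↦ le_trans hp' hy.2⟩
    · rintro ⟨hp, hmax⟩
      exact ⟨⟨hp.1, (hmax q hq.2).trans hq.1.2⟩, hp⟩
  · obtain ⟨B, hB, hBs⟩ := hgt
    intro h
    have := h ▸ incidenceVector_mem_basePolytope hB
    rw [hP₁] at this
    have h2 : coordSum A (incidenceVector B) ≤ s := this.2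
    rw [coordSum_incidenceVector] at h2
    exact absurd hBs (not_lt.2 (by exact_mod_cast h2))
  · obtain ⟨B, hB, hBs⟩ := hlt
    intro h
    have := h ▸ incidenceVector_mem_basePolytope hB
    rw [hP₂] at this
    have h2 : (s : ℝ) ≤ coordSum A (incidenceVector B) := this.2
    rw [coordSum_incidenceVector] at h2
    exact absurd hBs (not_lt.2 (by exact_mod_cast h2))

/-- If the bases of `N` meet `A` in at least `s` elements, then the part of its base polytope in
the half-space `x(A) ≤ s` is empty or a base polytope. -/
theorem exists_matroid_basePolytope_eq_inter {N : Matroid α} {A : Set α} {s : ℕ}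
    (hge : ∀ B, N.IsBase B → s ≤ (B ∩ A).ncard)
    (hne : (basePolytope N ∩ {p | coordSum A p ≤ s}).Nonempty) :
    ∃ L : Matroid α, L.E = N.E ∧ (∀ B, L.IsBase B ↔ N.IsBase B ∧ (B ∩ A).ncard ≤ s) ∧
      basePolytope L = basePolytope N ∩ {p | coordSum A p ≤ s} := by
  have hex : ∃ B, N.IsBase B ∧ (B ∩ A).ncard ≤ s := by
    by_contra! hcon
    obtain ⟨p, hp, hps : coordSum A p ≤ s⟩ := hne
    have := le_of_mem_basePolytope (-coordSum A) (-(s + 1)) (fun B hB ↦ ?_) hp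
    · rw [neg_apply] at this
      linarith
    · rw [neg_apply, coordSum_incidenceVector]
      exact neg_le_neg (by exact_mod_cast hcon B hB)
  obtain ⟨L, hLE, hL⟩ := exists_matroid_isBase_iff_ncard_inter_le hge hex
  exact ⟨L, hLE, hL, basePolytope_inter_le hL⟩

/-- Cutting off pieces by `x(A j) ≤ s j` one after the other. -/
theorem isHyperplaneSplitSequence_of_cuts {M : Matroid α} {m : ℕ} (hm : 0 < m)
    (A : ℕ → Set α) (s : ℕ → ℕ) (N R : ℕ → Matroid α)
    (hNE : ∀ j < m, (N j).E = M.E) (hRE : ∀ j < m, (R j).E = M.E)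
    (hR : ∀ j < m, ∀ B, (R j).IsBase B ↔ M.IsBase B ∧ ∀ i < j, s i ≤ (B ∩ A i).ncard)
    (hN : ∀ j < m, ∀ B, (N j).IsBase B ↔ (R j).IsBase B ∧ (B ∩ A j).ncard ≤ s j)
    (hlast : ∀ B, M.IsBase B → (B ∩ A (m - 1)).ncard ≤ s (m - 1))
    (hlt : ∀ j, j + 1 < m → ∃ B, (R j).IsBase B ∧ (B ∩ A j).ncard < s j)
    (hgt : ∀ j, j + 1 < m → ∃ B, (R j).IsBase B ∧ s j < (B ∩ A j).ncard) :
    IsHyperplaneSplitSequence M (fun j : Fin m ↦ N j) := by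
  have hRs : ∀ j, j + 1 < m → ∀ B,
      (R (j + 1)).IsBase B ↔ (R j).IsBase B ∧ s j ≤ (B ∩ A j).ncard := by
    intro j hj B
    rw [hR _ hj, hR _ (by omega)]
    constructor
    · rintro ⟨h, h'⟩
      exact ⟨⟨h, fun i hi ↦ h' i (by omega)⟩, h' j (by omega)⟩
    · rintro ⟨⟨h, h'⟩, h''⟩
      refine ⟨h, fun i hi ↦ ?_⟩
      rcases Nat.lt_succ_iff_lt_or_eq.1 hi with hi | rfl
      exacts [h' i hi, h'']
  have hR0 : R 0 = M := Matroid.ext_isBase (hRE 0 hm) fun B _ ↦ by simp [hR 0 hm]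
  -- The last inequality holds for every base of `M`, so it cuts nothing off.
  have hRlast : R (m - 1) = N (m - 1) :=
    Matroid.ext_isBase ((hRE _ (by omega)).trans (hNE _ (by omega)).symm) fun B _ ↦ by
      rw [hN _ (by omega), iff_self_and]
      exact fun h ↦ hlast B ((hR _ (by omega) B).1 h).1
  have hsplit : ∀ j, j + 1 < m → IsHyperplaneSplit (R j) (N j) (R (j + 1)) := fun j hj ↦
    isHyperplaneSplit_of_cut ((hNE _ (by omega)).trans (hRE _ (by omega)).symm)
      ((hRE _ hj).trans (hRE _ (by omega)).symm) (hN _ (by omega)) (hRs j hj)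
      (hlt j hj) (hgt j hj)
  have hRM : ∀ j < m, basePolytope (R j) ⊆ basePolytope M := fun j hj ↦
    basePolytope_mono fun B hB ↦ ((hR j hj B).1 hB).1
  have hcover : ∀ k, ∀ j < m, j + k + 1 = m →
      basePolytope (R j) ⊆ ⋃ i : Fin m, basePolytope (N i) := by
    intro k
    induction k with
    | zero =>
      intro j hj hk
      obtain rfl : j = m - 1 := by omega
      rw [hRlast]
      exact subset_iUnion (fun i : Fin m ↦ basePolytope (N i)) ⟨m - 1, hj⟩
    | succ k ih =>
      intro j hj hk
      rw [(hsplit j (by omega)).union]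
      exact union_subset (subset_iUnion (fun i : Fin m ↦ basePolytope (N i)) ⟨j, hj⟩)
        (ih (j + 1) (by omega) (by omega))
  have hinter : ∀ j k : Fin m, j < k → (basePolytope (N j) ∩ basePolytope (N k)).Nonempty →
      ∃ L : Matroid α, L.E = M.E ∧
        (∀ B, L.IsBase B ↔ (N j).IsBase B ∧ (N k).IsBase B) ∧
        basePolytope (N j) ∩ basePolytope (N k) = basePolytope L := by
    intro j k hjk hne
    have hjk' : (j : ℕ) < k := hjk
    have hNkR : ∀ B, (N k).IsBase B → (R j).IsBase B := fun B hB ↦ by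
      have := (hR k k.2 B).1 ((hN k k.2 B).1 hB).1
      exact (hR j j.2 B).2 ⟨this.1, fun i hi ↦ this.2 i (hi.trans hjk')⟩
    -- The later piece lies in the remainder `R j` and satisfies x(A j) ≥ s j, so meeting it with `N
    -- j` means taking its part with x(A j) = s j.
    have heq : basePolytope (N j) ∩ basePolytope (N k) =
        basePolytope (N k) ∩ {p | coordSum (A j) p ≤ s j} := by
      rw [basePolytope_inter_le (hN j j.2)]
      ext p
      constructor
      · rintro ⟨⟨-, h⟩, h'⟩
        exact ⟨h', h⟩
      · rintro ⟨h', h⟩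
        exact ⟨⟨basePolytope_mono hNkR h', h⟩, h'⟩
    rw [heq] at hne ⊢
    obtain ⟨L, hLE, hL, hLP⟩ := exists_matroid_basePolytope_eq_inter (fun B hB ↦
      ((hR k k.2 B).1 ((hN k k.2 B).1 hB).1).2 j hjk') hne
    refine ⟨L, hLE.trans (hNE k k.2), fun B ↦ ?_, hLP.symm⟩
    rw [hL, hN j j.2]
    exact ⟨fun h ↦ ⟨⟨hNkR B h.1, h.2⟩, h.1⟩, fun h ↦ ⟨h.2, h.1.2⟩⟩
  refine ⟨⟨fun j ↦ R j, fun j hj ↦ (congrArg R hj).trans hR0, fun j hj ↦ hsplit j hj, fun j hj ↦ ?_⟩,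
    ?_, fun j k hjk hne ↦ ?_⟩
  · obtain hj' : (j : ℕ) = m - 1 := by omega
    exact (congrArg R hj').trans (hRlast.trans (congrArg N hj').symm)
  · refine Subset.antisymm ?_ (iUnion_subset fun i ↦ ?_)
    · have := hcover (m - 1) 0 hm (by omega)
      rwa [hR0] at this
    · exact (basePolytope_mono fun B hB ↦ ((hN i i.2 B).1 hB).1).trans (hRM i i.2)
  · rcases lt_or_gt_of_ne hjk with h | h
    · exact hinter j k h hne
    · rw [inter_comm] at hne ⊢
      obtain ⟨L, hLE, hL, hLP⟩ := hinter k j h hne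
      exact ⟨L, hLE, fun B ↦ (hL B).trans and_comm, hLP⟩

end Splits

/-! ### Basis exchange under chain constraints -/

section CutChain

variable {α : Type*}

/-- A chain `∅ = A 0 ⊆ A 1 ⊆ ⋯ ⊆ A t = M.E` with numbers `0 = s 0 ≤ ⋯ ≤ s t = r(M)` such that
independent sets inside and outside `A n` with at most `s n` and `r(M) - s n` elements have an
independent union. -/
structure IsCutChain (M : Matroid α) (t : ℕ) (A : ℕ → Set α) (s : ℕ → ℕ) : Prop where
  mono : Monotone A
  zero : A 0 = ∅
  last : A t = M.E
  mono_card : Monotone s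
  card_zero : s 0 = 0
  card_last : ∀ B, M.IsBase B → B.ncard = s t
  indep : ∀ n ≤ t, ∀ X Y, M.Indep X → X ⊆ A n → X.ncard ≤ s n →
    M.Indep Y → Disjoint Y (A n) → Y.ncard + s n ≤ s t → M.Indep (X ∪ Y)

/-- The bases of `M` with at least `s n` elements in `A n` for `n ∈ L` and at most `s n` elements
in `A n` for `n ∈ U`. -/
def IsCutBase (M : Matroid α) (A : ℕ → Set α) (s : ℕ → ℕ) (L U : Set ℕ) (B : Set α) : Prop :=
  M.IsBase B ∧ (∀ n ∈ L, s n ≤ (B ∩ A n).ncard) ∧ ∀ n ∈ U, (B ∩ A n).ncard ≤ s n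

variable [Finite α] {M : Matroid α} {t : ℕ} {A : ℕ → Set α} {s : ℕ → ℕ}

theorem ncard_inter_add_ncard_sdiff (B A : Set α) : (B ∩ A).ncard + (B \ A).ncard = B.ncard :=
  ncard_inter_add_ncard_sdiff_eq_ncard B A (toFinite _)

theorem ncard_inter_sdiff_add {A A' : Set α} (h : A ⊆ A') (B : Set α) :
    (B ∩ (A' \ A)).ncard + (B ∩ A).ncard = (B ∩ A').ncard := by
  rw [← ncard_union_eq (disjoint_left.2 fun x hx hx' ↦ hx.2.2 hx'.2) (toFinite _) (toFinite _),
    ← inter_union_distrib_left, sdiff_union_of_subset h]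

theorem Matroid.Indep.isBase_of_ncard_le {I B : Set α} (hI : M.Indep I) (hB : M.IsBase B)
    (h : B.ncard ≤ I.ncard) : M.IsBase I := by
  obtain ⟨B', hB', hIB'⟩ := hI.exists_isBase_superset
  have hcard : B'.ncard = B.ncard := by
    rw [ncard_def, ncard_def, hB'.encard_eq_encard_of_isBase hB]
  rwa [eq_of_subset_of_ncard_le hIB' (by omega) (toFinite _)]

/-- When x leaves B, any replacement y in `A i \ A l` is safe, where i is the first tight lower
constraint containing x and l the last tight upper one avoiding it. Both are tight for B, and B' has
at least as many elements as B between them, so augmentation supplies y there. Gluing at i and at l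
then restores the rest of B. -/
theorem IsCutChain.exchange (h : IsCutChain M t A s) {L U : Set ℕ} (hL : ∀ n ∈ L, n ≤ t)
    (hU : ∀ n ∈ U, n ≤ t) : Matroid.ExchangeProperty (IsCutBase M A s L U) := by
  rintro B B' ⟨hB, hBL, hBU⟩ ⟨hB', hBL', hBU'⟩ x ⟨hx, hx'⟩
  have hBE : B ∩ A t = B := by rw [h.last, inter_eq_left.2 hB.subset_ground]
  have hBE' : B' ∩ A t = B' := by rw [h.last, inter_eq_left.2 hB'.subset_ground]
  -- the first tight lower constraint that removing `x` would violate
  obtain ⟨i, ⟨hit, hxi, hBi, hBi'⟩, himin⟩ : ∃ i, (i ≤ t ∧ x ∈ A i ∧ (B ∩ A i).ncard = s i ∧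
      s i ≤ (B' ∩ A i).ncard) ∧ ∀ n ∈ L, x ∈ A n → (B ∩ A n).ncard = s n → i ≤ n := by
    classical
    -- If no lower constraint in `L` is tight, `t` serves: every base has exactly `s t` elements in
    -- `A t`.
    have hex : ∃ n, n = t ∨ (n ∈ L ∧ x ∈ A n ∧ (B ∩ A n).ncard = s n) := ⟨t, Or.inl rfl⟩
    refine ⟨Nat.find hex, ?_, fun n hn hxn hBn ↦ Nat.find_min' hex (Or.inr ⟨hn, hxn, hBn⟩)⟩
    rcases Nat.find_spec hex with hs | hs
    · rw [hs, hBE, hBE', h.card_last B hB, h.card_last B' hB', h.last]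
      exact ⟨le_rfl, hB.subset_ground hx, rfl, le_rfl⟩
    · exact ⟨hL _ hs.1, hs.2.1, hs.2.2, hBL' _ hs.1⟩
  -- the last tight upper constraint that adding an element could violate
  obtain ⟨l, ⟨hlt, hxl, hBl, hBl'⟩, hlmax⟩ : ∃ l, (l ≤ t ∧ x ∉ A l ∧ (B ∩ A l).ncard = s l ∧
      (B' ∩ A l).ncard ≤ s l) ∧ ∀ n ∈ U, x ∉ A n → (B ∩ A n).ncard = s n → n ≤ l := by
    classical
    -- The default is 0, where `A 0` is empty and `s 0 = 0`.
    let P : ℕ → Prop := fun n ↦ n = 0 ∨ (n ∈ U ∧ x ∉ A n ∧ (B ∩ A n).ncard = s n)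
    refine ⟨Nat.findGreatest P t, ?_, fun n hn hxn hBn ↦
      Nat.le_findGreatest (hU n hn) (Or.inr ⟨hn, hxn, hBn⟩)⟩
    rcases Nat.findGreatest_spec (P := P) (Nat.zero_le t) (Or.inl rfl) with hs | hs
    · rw [hs]
      simp [h.zero, h.card_zero]
    · exact ⟨hU _ hs.1, hs.2.1, hs.2.2, hBU' _ hs.1⟩
  have hli : l ≤ i := by
    by_contra hcon
    exact hxl (h.mono (not_le.1 hcon).le hxi)
  have hAli := h.mono hli
  have hDB := ncard_inter_sdiff_add hAli B
  have hDB' := ncard_inter_sdiff_add hAli B'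
  set D := A i \ A l
  have hxD : x ∈ B ∩ D := ⟨hx, hxi, hxl⟩
  have hI := ncard_sdiff_singleton_add_one hxD (toFinite _)
  -- |B' ∩ D| ≥ s i - s l = |B ∩ D|, so the smaller set without `x` can be augmented.
  obtain ⟨y, ⟨⟨hyB', hyD⟩, hyI⟩, hyind⟩ :=
    (hB.indep.subset (sdiff_subset.trans inter_subset_left : (B ∩ D) \ {x} ⊆ B)).augment
      (hB'.indep.subset (inter_subset_left : B' ∩ D ⊆ B')) (by
        rw [← (toFinite _).cast_ncard_eq, ← (toFinite (B' ∩ D)).cast_ncard_eq]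
        exact_mod_cast (by omega))
  have hyx : y ≠ x := by rintro rfl; exact hx' hyB'
  have hyB : y ∉ B := fun hy ↦ hyI ⟨⟨hy, hyD⟩, hyx⟩
  have hcard : (insert y ((B ∩ D) \ {x})).ncard = (B ∩ D).ncard := by
    rw [ncard_insert_of_notMem hyI (toFinite _)]
    exact hI
  have hBcard := h.card_last B hB
  have hindep₁ : M.Indep (insert y ((B ∩ D) \ {x}) ∪ B \ A i) := by
    refine h.indep i hit _ _ hyind ?_ (by omega) (hB.indep.subset sdiff_subset)
      disjoint_sdiff_left ?_
    · exact insert_subset hyD.1 fun z hz ↦ hz.1.2.1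
    · have := ncard_inter_add_ncard_sdiff B (A i)
      omega
  have hindep₂ : M.Indep (B ∩ A l ∪ (insert y ((B ∩ D) \ {x}) ∪ B \ A i)) := by
    refine h.indep l hlt _ _ (hB.indep.subset inter_subset_left) inter_subset_right hBl.le
      hindep₁ ?_ ?_
    · rw [disjoint_left]
      rintro z ((rfl | hz) | hz) hzl
      exacts [hyD.2 hzl, hz.1.2.2 hzl, hz.2 (hAli hzl)]
    · have := ncard_inter_add_ncard_sdiff B (A i)
      have := ncard_union_le (insert y ((B ∩ D) \ {x})) (B \ A i)
      omega
  have hsub : insert y (B \ {x}) ⊆ B ∩ A l ∪ (insert y ((B ∩ D) \ {x}) ∪ B \ A i) := by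
    rintro z (rfl | ⟨hz, hzx⟩)
    · exact Or.inr (Or.inl (Or.inl rfl))
    · by_cases hzl : z ∈ A l
      · exact Or.inl ⟨hz, hzl⟩
      · by_cases hzi : z ∈ A i
        · exact Or.inr (Or.inl (Or.inr ⟨⟨hz, hzi, hzl⟩, hzx⟩))
        · exact Or.inr (Or.inr ⟨hz, hzi⟩)
  refine ⟨y, ⟨hyB', hyB⟩, (hindep₂.subset hsub).isBase_of_ncard_le hB ?_, fun n hn ↦ ?_,
    fun n hn ↦ ?_⟩
  · rw [ncard_exchange hyB hx]
  · by_cases hxn : x ∈ A n ∧ y ∉ A n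
    -- A tight n would satisfy i ≤ n, hence y ∈ A i ⊆ A n. The slack absorbs the loss of one
    -- element.
    · have hne : (B ∩ A n).ncard ≠ s n := fun heq ↦
        hxn.2 (h.mono (himin n hn hxn.1 heq) hyD.1)
      have := ncard_inter_le_exchange (A n) B x y
      have := hBL n hn
      omega
    · refine (hBL n hn).trans ?_
      by_cases hyn : y ∈ A n
      · have hsub : (B ∩ A n) \ {x} ⊆ insert y (B \ {x}) ∩ A n := fun z hz ↦
          ⟨Or.inr ⟨hz.1.1, hz.2⟩, hz.1.2⟩
        have hlt := ncard_lt_ncard (hsub.ssubset_of_mem_notMem (a := y) ⟨Or.inl rfl, hyn⟩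
          fun hy ↦ hyB hy.1.1) (toFinite _)
        have := ncard_le_ncard (subset_insert_sdiff_singleton x (B ∩ A n)) (toFinite _)
        have := ncard_insert_le x ((B ∩ A n) \ {x})
        omega
      · refine ncard_le_ncard (fun z hz ↦ ⟨Or.inr ⟨hz.1, ?_⟩, hz.2⟩) (toFinite _)
        rintro rfl
        exact hxn ⟨hz.2, hyn⟩
  · by_cases hyn : y ∈ A n ∧ x ∉ A n
    · have hne : (B ∩ A n).ncard ≠ s n := fun heq ↦
        hyD.2 (h.mono (hlmax n hn hyn.2 heq) hyn.1)
      have := ncard_exchange_inter_le (A n) B x y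
      have := hBU n hn
      omega
    · refine le_trans ?_ (hBU n hn)
      by_cases hxn : x ∈ A n
      · have hsub : insert y (B \ {x}) ∩ A n ⊆ insert y ((B ∩ A n) \ {x}) := by
          rintro z ⟨rfl | hz, hzn⟩
          exacts [Or.inl rfl, Or.inr ⟨⟨hz.1, hzn⟩, hz.2⟩]
        have h1 := ncard_le_ncard hsub (toFinite _)
        have h2 := ncard_insert_le y ((B ∩ A n) \ {x})
        have h3 := ncard_sdiff_singleton_add_one (s := B ∩ A n) ⟨hx, hxn⟩ (toFinite _)
        omega
      · refine ncard_le_ncard ?_ (toFinite _)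
        rintro z ⟨rfl | hz, hzn⟩
        · exact absurd ⟨hzn, hxn⟩ hyn
        · exact ⟨hz.1, hzn⟩

theorem IsCutChain.exists_matroid (h : IsCutChain M t A s) {L U : Set ℕ} (hL : ∀ n ∈ L, n ≤ t)
    (hU : ∀ n ∈ U, n ≤ t) (hne : ∃ B, IsCutBase M A s L U B) :
    ∃ N : Matroid α, N.E = M.E ∧ ∀ B, N.IsBase B ↔ IsCutBase M A s L U B :=
  ⟨Matroid.ofIsBaseOfFinite (E := M.E) (toFinite _) _ hne (h.exchange hL hU)
    fun _ hB ↦ hB.1.subset_ground, rfl, fun _ ↦ Iff.rfl⟩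

/-- Every difference `A (n + 1) \ A n` has rank more than `s (n + 1) - s n > 0`. -/
structure IsCutChain.IsStrict (M : Matroid α) (t : ℕ) (A : ℕ → Set α) (s : ℕ → ℕ) : Prop where
  lt : ∀ n < t, s n < s (n + 1)
  large : ∀ n < t, ∃ X ⊆ A (n + 1) \ A n, M.Indep X ∧ X.ncard + s n = s (n + 1) + 1

namespace IsCutChain

/-- Such a base is glued from independent sets of size s (n + 1) - s n, one in each difference. It
meets all constraints at once, so every constrained family is nonempty and all pieces share a base.
-/
theorem exists_base_ncard_inter_eq (h : IsCutChain M t A s) (hs : IsStrict M t A s) :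
    ∃ B, M.IsBase B ∧ ∀ n ≤ t, (B ∩ A n).ncard = s n := by
  have key : ∀ k ≤ t, ∃ I ⊆ A k, M.Indep I ∧ ∀ n ≤ k, (I ∩ A n).ncard = s n := by
    intro k
    induction k with
    | zero =>
      refine fun _ ↦ ⟨∅, empty_subset _, M.empty_indep, fun n hn ↦ ?_⟩
      obtain rfl : n = 0 := by omega
      simp [h.card_zero]
    | succ k ih =>
      intro hk
      obtain ⟨I, hIA, hI, hIs⟩ := ih (by omega)
      obtain ⟨X, hXA, hX, hXs⟩ := hs.large k (by omega)
      have hlt := hs.lt k (by omega)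
      obtain ⟨X', hX'X, hX's⟩ := exists_subset_card_eq (s := X) (n := s (k + 1) - s k) (by omega)
      have hIk := hIs k le_rfl
      rw [inter_eq_left.2 hIA] at hIk
      have hdisj : Disjoint X' (A k) := disjoint_left.2 fun z hz ↦ (hXA (hX'X hz)).2
      have hmono := h.mono_card hk
      refine ⟨I ∪ X', union_subset (hIA.trans (h.mono k.le_succ))
          fun z hz ↦ (hXA (hX'X hz)).1,
        h.indep k (by omega) I X' hI hIA hIk.le (hX.subset hX'X) hdisj (by omega),
        fun n hn ↦ ?_⟩
      rcases hn.eq_or_lt with rfl | hn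
      · rw [inter_eq_left.2 (union_subset (hIA.trans (h.mono k.le_succ))
          fun z hz ↦ (hXA (hX'X hz)).1), ncard_union_eq (hdisj.symm.mono_left hIA) (toFinite _)
          (toFinite _)]
        omega
      · rw [union_inter_distrib_right, (hdisj.mono_right (h.mono (by omega))).inter_eq,
          union_empty]
        exact hIs n (by omega)
  obtain ⟨I, hIA, hI, hIs⟩ := key t le_rfl
  obtain ⟨B, hB⟩ := M.exists_isBase
  refine ⟨I, hI.isBase_of_ncard_le hB ?_, hIs⟩
  have := hIs t le_rfl
  rw [inter_eq_left.2 hIA] at this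
  rw [h.card_last B hB, this]

/-- Taking one element too many from the difference `A (j + 1) \ A j` is compatible with gluing at
`A j`, because s (j + 1) < s t leaves room for it. -/
theorem exists_base_gt (h : IsCutChain M t A s) (hs : IsStrict M t A s) {j : ℕ} (hj : j + 1 < t) :
    ∃ B, M.IsBase B ∧ (∀ n ≤ j, s n ≤ (B ∩ A n).ncard) ∧
      s (j + 1) < (B ∩ A (j + 1)).ncard := by
  obtain ⟨B₀, hB₀, hB₀s⟩ := h.exists_base_ncard_inter_eq hs
  obtain ⟨X, hXA, hX, hXs⟩ := hs.large j (by omega)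
  have h1 := hs.lt (j + 1) hj
  have h2 := h.mono_card hj
  have hdisj : Disjoint X (A j) := disjoint_left.2 fun z hz ↦ (hXA hz).2
  have hI := h.indep j (by omega) (B₀ ∩ A j) X (hB₀.indep.subset inter_subset_left)
    inter_subset_right (hB₀s j (by omega)).le hX hdisj (by grind)
  obtain ⟨B, hB, hIB⟩ := hI.exists_isBase_superset
  refine ⟨B, hB, fun n hn ↦ ?_, ?_⟩
  · rw [← hB₀s n (by omega)]
    exact ncard_le_ncard (fun z hz ↦ ⟨hIB (Or.inl ⟨hz.1, h.mono hn hz.2⟩), hz.2⟩) (toFinite _)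
  · have hle : (B₀ ∩ A j ∪ X).ncard ≤ (B ∩ A (j + 1)).ncard := by
      refine ncard_le_ncard (subset_inter hIB (union_subset ?_ ?_)) (toFinite _)
      exacts [inter_subset_right.trans (h.mono j.le_succ), fun z hz ↦ (hXA hz).1]
    rw [ncard_union_eq (hdisj.symm.mono_left inter_subset_right) (toFinite _) (toFinite _),
      hB₀s j (by omega)] at hle
    omega

/-- Here the next difference `A (j + 2) \ A (j + 1)` receives one element too many, and s j < s (j +
1) leaves room for it. Too many elements outside `A (j + 1)` force too few inside. -/
theorem exists_base_lt (h : IsCutChain M t A s) (hs : IsStrict M t A s) {j : ℕ} (hj : j + 1 < t) :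
    ∃ B, M.IsBase B ∧ (∀ n ≤ j, s n ≤ (B ∩ A n).ncard) ∧
      (B ∩ A (j + 1)).ncard < s (j + 1) := by
  obtain ⟨B₀, hB₀, hB₀s⟩ := h.exists_base_ncard_inter_eq hs
  obtain ⟨X, hXA, hX, hXs⟩ := hs.large (j + 1) hj
  have h0 := hs.lt j (by omega)
  have h1 := hs.lt (j + 1) hj
  have h2 := h.mono_card hj
  have hcard := ncard_inter_add_ncard_sdiff B₀ (A (j + 1 + 1))
  rw [hB₀s (j + 1 + 1) hj, h.card_last B₀ hB₀] at hcard
  have hY := h.indep (j + 1 + 1) hj X (B₀ \ A (j + 1 + 1)) hX (fun z hz ↦ (hXA hz).1) (by omega)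
    (hB₀.indep.subset sdiff_subset) disjoint_sdiff_left (by omega)
  have hYs : (X ∪ B₀ \ A (j + 1 + 1)).ncard + s (j + 1) = s t + 1 := by
    rw [ncard_union_eq (disjoint_left.2 fun z hz hz' ↦ hz'.2 (hXA hz).1) (toFinite _)
      (toFinite _)]
    omega
  have hYA : Disjoint (X ∪ B₀ \ A (j + 1 + 1)) (A (j + 1)) :=
    disjoint_union_left.2 ⟨disjoint_left.2 fun z hz ↦ (hXA hz).2,
      disjoint_sdiff_left.mono_right (h.mono (j + 1).le_succ)⟩
  have hI := h.indep j (by omega) (B₀ ∩ A j) _ (hB₀.indep.subset inter_subset_left)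
    inter_subset_right (hB₀s j (by omega)).le hY (hYA.mono_right (h.mono j.le_succ)) (by omega)
  obtain ⟨B, hB, hIB⟩ := hI.exists_isBase_superset
  refine ⟨B, hB, fun n hn ↦ ?_, ?_⟩
  · rw [← hB₀s n (by omega)]
    exact ncard_le_ncard (fun z hz ↦ ⟨hIB (Or.inl ⟨hz.1, h.mono hn hz.2⟩), hz.2⟩) (toFinite _)
  · have hle : (X ∪ B₀ \ A (j + 1 + 1)).ncard ≤ (B \ A (j + 1)).ncard :=
      ncard_le_ncard (fun z hz ↦ ⟨hIB (Or.inr hz), disjoint_left.1 hYA hz⟩) (toFinite _)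
    have := ncard_inter_add_ncard_sdiff B (A (j + 1))
    rw [h.card_last B hB] at this
    omega

end IsCutChain

end CutChain

/-! ### Pieces and remainders of a strict chain -/

section Pieces

variable {α : Type*} {M : Matroid α} {t : ℕ} {A : ℕ → Set α} {s : ℕ → ℕ}

/-- The pieces and the remainders of the splits along `A 1, A 2, …`. -/
theorem IsCutChain.exists_pieces [Finite α] (h : IsCutChain M t A s) (hs : IsCutChain.IsStrict M t A s) :
    ∃ N R : ℕ → Matroid α, (∀ j < t, (N j).E = M.E) ∧ (∀ j < t, (R j).E = M.E) ∧
      (∀ j < t, ∀ B, (R j).IsBase B ↔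
        M.IsBase B ∧ ∀ i < j, s (i + 1) ≤ (B ∩ A (i + 1)).ncard) ∧
      (∀ j < t, ∀ B, (N j).IsBase B ↔ (R j).IsBase B ∧ (B ∩ A (j + 1)).ncard ≤ s (j + 1)) ∧
      (∀ j, j + 1 < t → ∃ B, (R j).IsBase B ∧ (B ∩ A (j + 1)).ncard < s (j + 1)) ∧
      ∀ j, j + 1 < t → ∃ B, (R j).IsBase B ∧ s (j + 1) < (B ∩ A (j + 1)).ncard := by
  obtain ⟨B₀, hB₀, hB₀s⟩ := h.exists_base_ncard_inter_eq hs
  -- Indices are shifted by one, as `A 0` is empty: the remainder `R j` obeys the lower constraints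
  -- 1, …, j.
  have hL : ∀ j < t, ∀ n ∈ {n | ∃ i < j, n = i + 1}, n ≤ t := by
    rintro j hj _ ⟨i, hi, rfl⟩
    omega
  have key : ∀ j, ∃ N R : Matroid α, j < t → N.E = M.E ∧ R.E = M.E ∧
      (∀ B, R.IsBase B ↔ M.IsBase B ∧ ∀ i < j, s (i + 1) ≤ (B ∩ A (i + 1)).ncard) ∧
      (∀ B, N.IsBase B ↔ R.IsBase B ∧ (B ∩ A (j + 1)).ncard ≤ s (j + 1)) := by
    intro j
    by_cases hj : j < t
    swap
    · exact ⟨M, M, fun h ↦ absurd h hj⟩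
    obtain ⟨R, hRE, hR⟩ := h.exists_matroid (L := {n | ∃ i < j, n = i + 1}) (U := ∅) (hL j hj)
      (by simp) ⟨B₀, hB₀, fun n hn ↦ (hB₀s n (hL j hj n hn)).ge, by simp⟩
    obtain ⟨N, hNE, hN⟩ := h.exists_matroid (L := {n | ∃ i < j, n = i + 1}) (U := {j + 1})
      (hL j hj) (by rintro _ rfl; omega)
      ⟨B₀, hB₀, fun n hn ↦ (hB₀s n (hL j hj n hn)).ge, by
        rintro _ rfl
        exact (hB₀s _ (by omega)).le⟩
    refine ⟨N, R, fun _ ↦ ⟨hNE, hRE, fun B ↦ ?_, fun B ↦ ?_⟩⟩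
    · rw [hR, IsCutBase]
      refine and_congr_right fun _ ↦ ⟨fun hB i hi ↦ hB.1 _ ⟨i, hi, rfl⟩, fun hB ↦ ⟨?_, by simp⟩⟩
      rintro _ ⟨i, hi, rfl⟩
      exact hB i hi
    · rw [hR, hN, IsCutBase, IsCutBase]
      simp [and_assoc]
  choose N R hNR using key
  refine ⟨N, R, fun j hj ↦ (hNR j hj).1, fun j hj ↦ (hNR j hj).2.1, fun j hj ↦ (hNR j hj).2.2.1,
    fun j hj ↦ (hNR j hj).2.2.2, fun j hj ↦ ?_, fun j hj ↦ ?_⟩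
  · obtain ⟨B, hB, hBs, hlt⟩ := h.exists_base_lt hs hj
    exact ⟨B, ((hNR j (by omega)).2.2.1 B).2 ⟨hB, fun i hi ↦ hBs (i + 1) hi⟩, hlt⟩
  · obtain ⟨B, hB, hBs, hgt⟩ := h.exists_base_gt hs hj
    exact ⟨B, ((hNR j (by omega)).2.2.1 B).2 ⟨hB, fun i hi ↦ hBs (i + 1) hi⟩, hgt⟩

theorem IsCutChain.ncard_inter_last (h : IsCutChain M t A s) {B : Set α} (hB : M.IsBase B) :
    (B ∩ A t).ncard = s t := by
  rw [h.last, inter_eq_left.2 hB.subset_ground, h.card_last B hB]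

end Pieces

/-! ### Relaxing a circuit-hyperplane -/

section Relaxation

variable {α : Type*} {M M' : Matroid α} {X : Set α}

theorem IsCircuitHyperplane.ncard_eq (hX : IsCircuitHyperplane M X) {B : Set α}
    (hB : M.IsBase B) : X.ncard = B.ncard := by
  rw [ncard_def, ncard_def, ← hX.isCircuit.eRk_add_one_eq, hX.rank_add_one, hB.encard_eq_eRank]

/-- Removing z from the circuit leaves an independent set of r - 1 elements, whose closure stays in
the flat X and so misses y. -/
theorem IsCircuitHyperplane.isBase_exchange [Finite α] (hX : IsCircuitHyperplane M X) {y z : α}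
    (hy : y ∈ M.E \ X) (hz : z ∈ X) : M.IsBase (insert y (X \ {z})) := by
  have hI := hX.isCircuit.sdiff_singleton_indep hz
  have hycl : y ∉ M.closure (X \ {z}) := fun h ↦
    hy.2 (hX.isFlat.closure ▸ M.closure_subset_closure sdiff_subset h)
  have hI' : M.Indep (insert y (X \ {z})) := by
    rw [hI.notMem_closure_iff hy.1] at hycl
    exact hycl.1
  obtain ⟨B, hB⟩ := M.exists_isBase
  refine hI'.isBase_of_ncard_le hB ?_
  rw [ncard_exchange hy.2 hz, hX.ncard_eq hB]

theorem indep_relaxation_iff (hX : IsCircuitHyperplane M X)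
    (hB' : ∀ B, M'.IsBase B ↔ M.IsBase B ∨ B = X) {I : Set α} : M'.Indep I ↔ M.Indep I ∨ I = X := by
  constructor
  · intro hI
    obtain ⟨B, hB, hIB⟩ := hI.exists_isBase_superset
    rcases (hB' B).1 hB with hB | rfl
    · exact Or.inl (hB.indep.subset hIB)
    · rcases hIB.eq_or_ssubset with h | h
      · exact Or.inr h
      · exact Or.inl (hX.isCircuit.ssubset_indep h)
  · rintro (hI | rfl)
    · obtain ⟨B, hB, hIB⟩ := hI.exists_isBase_superset
      exact ((hB' B).2 (Or.inl hB)).indep.subset hIB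
    · exact ((hB' _).2 (Or.inr rfl)).indep

/-- The only new independent set is X, with `s t` elements. Two nonempty sets to be glued have at
most `s t` elements together, so neither is X and gluing takes place in M. -/
theorem IsCutChain.relaxation [Finite α] (hX : IsCircuitHyperplane M X)
    (hB' : ∀ B, M'.IsBase B ↔ M.IsBase B ∨ B = X)
    {t : ℕ} {A : ℕ → Set α} {s : ℕ → ℕ} (h : IsCutChain M t A s)
    (hE : M'.E = M.E) : IsCutChain M' t A s := by
  obtain ⟨B, hB⟩ := M.exists_isBase
  have hXs : X.ncard = s t := (hX.ncard_eq hB).trans (h.card_last B hB)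
  refine ⟨h.mono, h.zero, h.last.trans hE.symm, h.mono_card, h.card_zero, fun B hB ↦ ?_,
    fun n hn I J hI hIA hIs hJ hJA hJs ↦ ?_⟩
  · rcases (hB' B).1 hB with hB | rfl
    exacts [h.card_last B hB, hXs]
  · rcases I.eq_empty_or_nonempty with rfl | hne
    · rwa [empty_union]
    rcases J.eq_empty_or_nonempty with rfl | hne'
    · rwa [union_empty]
    have hI0 := hne.ncard_pos
    have hJ0 := hne'.ncard_pos
    rw [indep_relaxation_iff hX hB'] at hI hJ ⊢
    refine Or.inl (h.indep n hn I J (hI.resolve_right ?_) hIA hIs (hJ.resolve_right ?_) hJA hJs)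
    · rintro rfl
      omega
    · rintro rfl
      omega

theorem IsCutChain.IsStrict.relaxation (hX : IsCircuitHyperplane M X)
    (hB' : ∀ B, M'.IsBase B ↔ M.IsBase B ∨ B = X)
    {t : ℕ} {A : ℕ → Set α} {s : ℕ → ℕ}
    (h : IsCutChain.IsStrict M t A s) : IsCutChain.IsStrict M' t A s :=
  ⟨h.lt, fun n hn ↦ by
    obtain ⟨Y, hYA, hY, hYs⟩ := h.large n hn
    exact ⟨Y, hYA, (indep_relaxation_iff hX hB').2 (Or.inl hY), hYs⟩⟩

/-- The bases of a relaxation with at most one element outside the relaxed circuit-hyperplane form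
a matroid. -/
theorem exists_matroid_near_circuitHyperplane [Finite α] (hX : IsCircuitHyperplane M X)
    (hB' : ∀ B, M'.IsBase B ↔ M.IsBase B ∨ B = X)
    (hE : M'.E = M.E) :
    ∃ N : Matroid α, N.E = M'.E ∧
      ∀ B, N.IsBase B ↔ M'.IsBase B ∧ (B ∩ (M.E \ X)).ncard ≤ 1 := by
  have hX0 : 0 < X.ncard := hX.isCircuit.nonempty.ncard_pos
  have hXE : X ⊆ M.E := hX.isCircuit.subset_ground
  -- The chain ∅ ⊆ E \ X ⊆ E with numbers 0, 1, |X| is a cut chain of `M'`: a proper subset of X and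
  -- one element y outside X lie in a common base X - z + y.
  let A : ℕ → Set α := fun n ↦ if n = 0 then ∅ else if n = 1 then M.E \ X else M.E
  let s : ℕ → ℕ := fun n ↦ if n = 0 then 0 else if n = 1 then 1 else X.ncard
  have h : IsCutChain M' 2 A s := by
    refine ⟨monotone_nat_of_le_succ fun n ↦ ?_, rfl, hE.symm,
      monotone_nat_of_le_succ fun n ↦ ?_, rfl, fun B hB ↦ ?_, fun n hn I J hI hIA hIs hJ hJA hJs ↦ ?_⟩
    · rcases n with _ | _ | n
      exacts [empty_subset _, sdiff_subset, le_rfl]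
    · rcases n with _ | _ | n
      exacts [Nat.zero_le _, hX0, le_rfl]
    · rcases (hB' B).1 hB with hB | rfl
      exacts [(hX.ncard_eq hB).symm, rfl]
    · rcases I.eq_empty_or_nonempty with rfl | ⟨y, hy⟩
      · rwa [empty_union]
      interval_cases n
      · exact absurd (hIA hy) (notMem_empty y)
      · have hIA' : I ⊆ M.E \ X := hIA
        have hIs' : I.ncard ≤ 1 := hIs
        have hJA' : Disjoint J (M.E \ X) := hJA
        have hJs' : J.ncard + 1 ≤ X.ncard := hJs
        have hJX : J ⊆ X := fun z hz ↦ by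
          by_contra hzX
          exact disjoint_left.1 hJA' hz ⟨hE ▸ hJ.subset_ground hz, hzX⟩
        obtain ⟨z, hzX, hzJ⟩ := exists_mem_notMem_of_ncard_lt_ncard (s := J) (t := X) hJs'
        refine ((hB' _).2 (Or.inl (hX.isBase_exchange (hIA' hy) hzX))).indep.subset
          (union_subset (fun w hw ↦ ?_) fun w hw ↦ Or.inr ⟨hJX hw, ?_⟩)
        · exact Or.inl ((ncard_le_one_iff (toFinite _)).1 hIs' hw hy)
        · rintro rfl
          exact hzJ hw
      · have hJ0 : J = ∅ := by
          refine eq_empty_of_forall_notMem fun z hz ↦ disjoint_left.1 hJA hz ?_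
          have hzE := hJ.subset_ground hz
          rwa [hE] at hzE
        rwa [hJ0, union_empty]
  obtain ⟨N, hNE, hN⟩ := h.exists_matroid (L := ∅) (U := {1}) (by simp) (by simp)
    ⟨X, (hB' X).2 (Or.inr rfl), by simp, by
      rintro _ rfl
      have : X ∩ A 1 = ∅ := disjoint_sdiff_right.inter_eq
      simp [this]⟩
  refine ⟨N, hNE, fun B ↦ ?_⟩
  rw [hN, IsCutBase]
  simp [A, s]

/-- A matroid with a strict chain of length at least two has a base with two elements outside a
given circuit-hyperplane. -/
theorem IsCutChain.exists_base_one_lt [Finite α] {t : ℕ} {A : ℕ → Set α} {s : ℕ → ℕ}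
    (h : IsCutChain M t A s) (hs : IsCutChain.IsStrict M t A s) (ht : 2 ≤ t)
    (hX : IsCircuitHyperplane M X) : ∃ B, M.IsBase B ∧ 1 < (B ∩ (M.E \ X)).ncard := by
  by_contra! hcon
  have hind : ∀ I, M.Indep I → (I \ X).ncard ≤ 1 := fun I hI ↦ by
    obtain ⟨B, hB, hIB⟩ := hI.exists_isBase_superset
    have hsub : I \ X ⊆ B ∩ (M.E \ X) := fun z hz ↦
      ⟨hIB hz.1, hI.subset_ground hz.1, hz.2⟩
    exact (ncard_le_ncard hsub (toFinite _)).trans (hcon B hB)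
  obtain ⟨B₁, hB₁, -, hgt⟩ := h.exists_base_gt hs (j := 0) (by omega)
  obtain ⟨B₂, hB₂, -, hlt⟩ := h.exists_base_lt hs (j := 0) (by omega)
  simp only [zero_add] at hgt hlt
  have h01 : s 0 < s 1 := hs.lt 0 (by omega)
  have h12 : s 1 < s 2 := hs.lt 1 (by omega)
  have h2t := h.mono_card ht
  have hc₂ := ncard_inter_add_ncard_sdiff B₂ (A 1)
  rw [h.card_last B₂ hB₂] at hc₂
  have hXs : X.ncard = s t := (hX.ncard_eq hB₂).trans (h.card_last B₂ hB₂)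
  have hdisj : Disjoint (B₁ ∩ A 1) (B₂ \ A 1) := disjoint_left.2 fun z hz hz' ↦ hz'.2 hz.2
  have hXsplit : (B₁ ∩ A 1 ∩ X).ncard + ((B₂ \ A 1) ∩ X).ncard ≤ X.ncard := by
    rw [← ncard_union_eq (hdisj.mono inter_subset_left inter_subset_left) (toFinite _)
      (toFinite _)]
    exact ncard_le_ncard (union_subset inter_subset_right inter_subset_right) (toFinite _)
  have hI : M.Indep (B₁ ∩ A 1) := hB₁.indep.subset inter_subset_left
  have hJ : M.Indep (B₂ \ A 1) := hB₂.indep.subset sdiff_subset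
  have h1 := ncard_inter_add_ncard_sdiff (B₁ ∩ A 1) X
  have h2 := ncard_inter_add_ncard_sdiff (B₂ \ A 1) X
  have h3 := hind _ hI
  have h4 := hind _ hJ
  -- `B₁ ∩ A 1` and `B₂ \ A 1` have at least |X| + 2 elements together, at most |X| of them in X,
  -- and each has at most one outside X. Hence each has one outside, and gluing these two gives a
  -- contradiction.
  obtain ⟨y, hy⟩ : ((B₁ ∩ A 1) \ X).Nonempty := nonempty_of_ncard_ne_zero (by omega)
  obtain ⟨z, hz⟩ : ((B₂ \ A 1) \ X).Nonempty := nonempty_of_ncard_ne_zero (by omega)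
  have hyz := h.indep 1 (by omega) {y} {z} (hI.subset (singleton_subset_iff.2 hy.1))
    (singleton_subset_iff.2 hy.1.2) (by rw [ncard_singleton]; omega)
    (hJ.subset (singleton_subset_iff.2 hz.1)) (disjoint_singleton_left.2 hz.1.2)
    (by rw [ncard_singleton]; omega)
  have hne : y ≠ z := fun hyz ↦ hz.1.2 (hyz ▸ hy.1.2)
  have h5 := hind _ hyz
  have h6 : ({y} ∪ {z} : Set α) \ X = {y, z} := by
    rw [singleton_union, sdiff_eq_left, disjoint_left]
    rintro w (rfl | rfl)
    exacts [hy.2, hz.2]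
  rw [h6, ncard_pair hne] at h5
  omega

end Relaxation

/-! ### The chain of a good partition -/

section GoodPartition

variable {α : Type*} {t : ℕ}

/-- The union of the first `n` parts. -/
def prefixUnion (E : Fin t → Set α) (n : ℕ) : Set α :=
  {x | ∃ i : Fin t, (i : ℕ) < n ∧ x ∈ E i}

/-- The sum of the first `n` numbers. -/
def prefixSum (a : Fin t → ℕ) (n : ℕ) : ℕ :=
  ∑ i ∈ Finset.univ.filter (fun i : Fin t ↦ (i : ℕ) < n), a i

theorem partUnion_Iic (E : Fin t → Set α) (j : Fin t) :
    partUnion E (Finset.Iic j) = prefixUnion E (j + 1) := by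
  ext x
  simp only [partUnion, prefixUnion, mem_iUnion, Finset.mem_Iic, exists_prop, mem_ofPred_eq,
    Order.lt_add_one_iff, Fin.val_fin_le]

theorem sum_Iic_eq_prefixSum (a : Fin t → ℕ) (j : Fin t) :
    ∑ i ∈ Finset.Iic j, a i = prefixSum a (j + 1) := by
  rw [prefixSum]
  congr 1
  ext i
  simp only [Finset.mem_Iic, Finset.mem_filter_univ, Order.lt_add_one_iff, Fin.val_fin_le]

theorem prefixSum_succ (a : Fin t → ℕ) {n : ℕ} (hn : n < t) :
    prefixSum a (n + 1) = prefixSum a n + a ⟨n, hn⟩ := by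
  have : Finset.univ.filter (fun i : Fin t ↦ (i : ℕ) < n + 1) =
      insert ⟨n, hn⟩ (Finset.univ.filter fun i : Fin t ↦ (i : ℕ) < n) := by
    ext i
    simp [Fin.ext_iff, Nat.le_iff_lt_or_eq, or_comm]
  rw [prefixSum, this, Finset.sum_insert (by simp), add_comm, prefixSum]

theorem prefixSum_add_sum_Ioi (a : Fin t → ℕ) (j : Fin t) :
    prefixSum a (j + 1) + ∑ i ∈ Finset.Ioi j, a i = prefixSum a t := by
  rw [← sum_Iic_eq_prefixSum, ← Finset.sum_union]
  · refine Finset.sum_congr ?_ fun _ _ ↦ rfl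
    ext i
    simp [le_or_gt]
  · exact Finset.disjoint_left.2 fun i hi hi' ↦
      absurd (Finset.mem_Iic.1 hi) (not_le.2 (Finset.mem_Ioi.1 hi'))

variable [Finite α] {M : Matroid α} {E : Fin t → Set α} {a : Fin t → ℕ}

/-- Condition (a) is the gluing property for 0 < n < t; at n = 0 and n = t one of the two sets is
empty. -/
theorem IsGoodPartition.isCutChain (h : IsGoodPartition M E a) :
    IsCutChain M t (prefixUnion E) (prefixSum a) := by
  have hlast : prefixUnion E t = M.E := by
    rw [← h.union]
    ext x
    simp [prefixUnion]
  refine ⟨fun m n hmn x ⟨i, hi, hx⟩ ↦ ⟨i, hi.trans_le hmn, hx⟩, by simp [prefixUnion], hlast,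
    fun m n hmn ↦ Finset.sum_le_sum_of_subset fun i hi ↦ ?_, by simp [prefixSum],
    fun B hB ↦ ?_, fun n hn X Y hX hXA hXs hY hYA hYs ↦ ?_⟩
  · simp only [Finset.mem_filter_univ] at hi ⊢
    omega
  · rw [ncard_def, hB.encard_eq_eRank, h.sum_eq, ENat.toNat_natCast]
    simp [prefixSum]
  · rcases n with _ | j
    · obtain rfl : X = ∅ := eq_empty_of_forall_notMem fun x hx ↦ by
        simpa [prefixUnion] using hXA hx
      rwa [empty_union]
    rcases hn.eq_or_lt with hn | hn
    · obtain rfl : Y = ∅ := by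
        rw [hn, hlast] at hYA
        exact hYA.eq_bot_of_le hY.subset_ground
      rwa [union_empty]
    have hsum := prefixSum_add_sum_Ioi a ⟨j, by omega⟩
    refine h.indep_two ⟨j, by omega⟩ hn X Y ?_ ?_ ?_ ?_
    · rw [Matroid.restrict_indep_iff, partUnion_Iic]
      exact ⟨hX, hXA⟩
    · rw [← (toFinite X).cast_ncard_eq, sum_Iic_eq_prefixSum]
      exact_mod_cast hXs
    · refine Matroid.restrict_indep_iff.2 ⟨hY, fun y hy ↦ ?_⟩
      have hyE := hY.subset_ground hy
      rw [← h.union, mem_iUnion] at hyE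
      obtain ⟨i, hi⟩ := hyE
      refine mem_iUnion₂.2 ⟨i, Finset.mem_Ioi.2 (lt_of_not_ge fun hij ↦ ?_), hi⟩
      exact disjoint_left.1 hYA hy ⟨i, Nat.lt_succ_of_le hij, hi⟩
    · rw [← (toFinite Y).cast_ncard_eq]
      simp only at hsum
      exact_mod_cast (by omega)

theorem IsGoodPartition.isStrict (h : IsGoodPartition M E a) :
    IsCutChain.IsStrict M t (prefixUnion E) (prefixSum a) := by
  refine ⟨fun n hn ↦ ?_, fun n hn ↦ ?_⟩
  · have := h.pos ⟨n, hn⟩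
    rw [prefixSum_succ a hn]
    omega
  · obtain ⟨B, hB⟩ := (M ↾ E ⟨n, hn⟩).exists_isBase
    have hlt := h.lt_rank ⟨n, hn⟩
    rw [← hB.encard_eq_eRank, ← (toFinite B).cast_ncard_eq] at hlt
    have hlt' : a ⟨n, hn⟩ < B.ncard := by exact_mod_cast hlt
    obtain ⟨X, hXB, hXs⟩ := exists_subset_card_eq (s := B) (n := a ⟨n, hn⟩ + 1) hlt'
    have hBi := Matroid.restrict_indep_iff.1 hB.indep
    refine ⟨X, fun x hx ↦ ⟨⟨⟨n, hn⟩, n.lt_succ_self, hBi.2 (hXB hx)⟩, ?_⟩, hBi.1.subset hXB, ?_⟩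
    · rintro ⟨i, hi, hxi⟩
      refine disjoint_left.1 (h.disjoint i ⟨n, hn⟩ ?_) hxi (hBi.2 (hXB hx))
      rintro rfl
      exact lt_irrefl _ hi
    · rw [prefixSum_succ a hn]
      omega

end GoodPartition

/-! ### The two split sequences -/

section Main

variable {α : Type*} [Finite α] {M M' : Matroid α} {t : ℕ} {A : ℕ → Set α} {s : ℕ → ℕ}

/-- The relaxation of a matroid with a strict chain is split into one piece around the relaxed
circuit-hyperplane and the pieces of the original matroid. -/
theorem IsCutChain.exists_splitSequence_relaxation (h : IsCutChain M t A s)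
    (hs : IsCutChain.IsStrict M t A s) (ht : 2 ≤ t) (hrel : IsRelaxation M M') :
    ∃ N : Fin (t + 1) → Matroid α, IsHyperplaneSplitSequence M' N := by
  obtain ⟨X, hX, hE, hB'⟩ := hrel
  obtain ⟨N₀, hN₀E, hN₀⟩ := exists_matroid_near_circuitHyperplane hX hB' hE
  obtain ⟨N, R, hNE, hRE, hR, hN, hlt, hgt⟩ := h.exists_pieces hs
  -- A base of `M` contained in X would equal X by cardinality, but X is a circuit.
  have hMX : ∀ B, M.IsBase B ↔ M'.IsBase B ∧ 1 ≤ (B ∩ (M.E \ X)).ncard := by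
    intro B
    rw [hB', Nat.one_le_iff_ne_zero, Ne, ncard_eq_zero (toFinite _)]
    constructor
    · refine fun hB ↦ ⟨Or.inl hB, fun h0 ↦ hX.isCircuit.not_indep ?_⟩
      have hBX : B ⊆ X := fun z hz ↦ by
        by_contra hzX
        exact (h0 ▸ (⟨hz, hB.subset_ground hz, hzX⟩ : z ∈ B ∩ (M.E \ X)) : z ∈ (∅ : Set α))
      rw [← eq_of_subset_of_ncard_le hBX (hX.ncard_eq hB).le (toFinite _)]
      exact hB.indep
    · rintro ⟨hB | rfl, hne⟩
      · exact hB
      · exact absurd disjoint_sdiff_right.inter_eq hne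
  have hXM' : M'.IsBase X := (hB' X).2 (Or.inr rfl)
  have hcard := (h.relaxation hX hB' hE).card_last
  -- The unused index 0 of the chain is given to the new cut x(E \ X) = 1; the remainder after it is
  -- `M`, and the cuts at n ≥ 1 are those of the chain.
  refine ⟨_, isHyperplaneSplitSequence_of_cuts (M := M') (m := t + 1) t.succ_pos
    (fun n ↦ if n = 0 then M.E \ X else A n) (fun n ↦ if n = 0 then 1 else s n)
    (fun n ↦ Nat.casesOn n N₀ N) (fun n ↦ Nat.casesOn n M' R) ?_ ?_ ?_ ?_ ?_ ?_ ?_⟩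
  · rintro (_ | j) hj
    exacts [hN₀E, (hNE j (by omega)).trans hE.symm]
  · rintro (_ | j) hj
    exacts [rfl, (hRE j (by omega)).trans hE.symm]
  · rintro (_ | j) hj B
    · simp
    · refine (hR j (by omega) B).trans ?_
      rw [hMX, and_assoc]
      refine and_congr_right fun _ ↦ ⟨fun hB i hi ↦ ?_, fun hB ↦ ⟨?_, fun i hi ↦ ?_⟩⟩
      · rcases i with _ | i
        · exact hB.1
        · exact hB.2 i (by omega)
      · exact hB 0 (by omega)
      · exact hB (i + 1) (by omega)
  · rintro (_ | j) hj B
    · exact hN₀ B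
    · exact hN j (by omega) B
  · intro B hB
    rw [Nat.add_sub_cancel, if_neg (by omega), if_neg (by omega)]
    exact ((h.relaxation hX hB' hE).ncard_inter_last hB).le
  · rintro (_ | j) hj
    · refine ⟨X, hXM', ?_⟩
      simp [disjoint_sdiff_right.inter_eq]
    · exact hlt j (by omega)
  · rintro (_ | j) hj
    · obtain ⟨B, hB, hBX⟩ := h.exists_base_one_lt hs ht hX
      exact ⟨B, (hB' B).2 (Or.inl hB), hBX⟩
    · exact hgt j (by omega)

end Main

theorem corollary2 {α : Type*} [Finite α] (M M' : Matroid α) {t : ℕ}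
    (E : Fin t → Set α) (a : Fin t → ℕ) (hgood : IsGoodPartition M E a)
    (hrel : IsRelaxation M M') :
    (∃ N : Fin t → Matroid α,
      (∀ j, (N j).E = M'.E ∧ ∀ B, (N j).IsBase B ↔
        M'.IsBase B ∧
        (∀ i, i < j → ∑ l ∈ Finset.Iic i, a l ≤ (B ∩ partUnion E (Finset.Iic i)).ncard) ∧
        (B ∩ partUnion E (Finset.Iic j)).ncard ≤ ∑ l ∈ Finset.Iic j, a l) ∧
      IsHyperplaneSplitSequence M' N ∧
      ∀ j k, ∃ B, (N j).IsBase B ∧ (N k).IsBase B) ∧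
    ∃ N : Fin (t + 1) → Matroid α, IsHyperplaneSplitSequence M' N := by
  have ht := hgood.two_le
  have hc := hgood.isCutChain
  have hs := hgood.isStrict
  refine ⟨?_, hc.exists_splitSequence_relaxation hs ht hrel⟩
  obtain ⟨X, hX, hE, hB'⟩ := hrel
  replace hc := hc.relaxation hX hB' hE
  replace hs := hs.relaxation hX hB'
  obtain ⟨N, R, hNE, hRE, hR, hN, hlt, hgt⟩ := hc.exists_pieces hs
  obtain ⟨B₀, hB₀, hB₀s⟩ := hc.exists_base_ncard_inter_eq hs
  -- A base that is tight at every cut lies in all pieces.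
  have hB₀N : ∀ j : Fin t, (N j).IsBase B₀ := fun j ↦
    (hN j j.2 B₀).2 ⟨(hR j j.2 B₀).2 ⟨hB₀, fun i hi ↦ (hB₀s (i + 1) (by omega)).ge⟩,
      (hB₀s (j + 1) (by omega)).le⟩
  refine ⟨fun j ↦ N j, fun j ↦ ⟨hNE j j.2, fun B ↦ ?_⟩, ?_, fun j k ↦ ⟨B₀, hB₀N j, hB₀N k⟩⟩
  · simp only [partUnion_Iic, sum_Iic_eq_prefixSum]
    rw [hN j j.2, hR j j.2, and_assoc]
    refine and_congr_right fun _ ↦ and_congr_left fun _ ↦ ?_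
    exact ⟨fun hB i hi ↦ hB i hi, fun hB i hi ↦ hB ⟨i, hi.trans j.2⟩ hi⟩
  · refine isHyperplaneSplitSequence_of_cuts (by omega) (fun n ↦ prefixUnion E (n + 1))
      (fun n ↦ prefixSum a (n + 1)) N R hNE hRE hR hN (fun B hB ↦ ?_) hlt hgt
    rw [Nat.sub_add_cancel (by omega)]
    exact (hc.ncard_inter_last hB).le
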